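/- A group is said to have the POEC property if any two of its elements of prime order (the primes being equal or different) commute. Let $G$ be a finite perfect group (that is, $G=[G,G]$) with the POEC property, and let $p$ be a prime dividing $|G|$. Suppose that at least one of the following two conditions holds: (a) at least one of the integers $2^4$, $3$, $5$ does not divide $|G|$; (b) $p\not\equiv 1 \pmod{10}$ and $p\not\equiv -1 \pmod{10}$. Then $p^3$ divides $|G|$. -/

import Mathlib

/-- A group has the POEC property if any two elements of prime order
(the two primes may be equal or different) commute. -/
def IsPOEC (G : Type*) [Group G] : Prop :=
  ∀ x y : G, (orderOf x).Prime → (orderOf y).Prime → Commute x y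

/-! Suppose $p^3\nmid|G|$. A Sylow subgroup $P$ is then abelian of exponent dividing $p^2$, and by
POEC the solutions of $x^p=1$ form a normal elementary abelian subgroup $\Omega\le P$.

If $|\Omega|=p$, then $\Omega$ is central because $\mathrm{Aut}(\Omega)$ is abelian. The normalizer
of $P$ then centralizes $P$, and transfer contradicts perfectness. So $P=\Omega$ has order $p^2$,
and conjugation maps $G$ to $SL_2(\mathbb F_p)$ with kernel containing $P$; by transfer again the
image is nontrivial.

The image is perfect of order prime to $p$. Klein's orbit count on the projective line gives order
60 modulo scalars, and the involution $-1$ gives a further factor 2, so 120 divides its order. Hence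
5 divides $|SL_2(\mathbb F_p)|$, which forces $p\equiv\pm1\pmod{10}$. By POEC the involutions of $G$
centralize $\Omega$, so the kernel has even order and $240=2^4\cdot3\cdot5$ divides $|G|$. Both (a)
and (b) fail. -/

/-! ### Perfect groups, small actions and Klein's orbit count -/

theorem Group.IsPerfect.map_eq_one {G A : Type*} [Group G] [Group.IsPerfect G] [Group A]
    [Group.IsSolvable A] (f : G →* A) (g : G) : f g = 1 := by
  have : Group.IsPerfect f.range := Group.IsPerfect.range f
  by_contra hg
  have : Nontrivial f.range := ⟨⟨⟨f g, g, rfl⟩, 1, fun h => hg (congrArg Subtype.val h)⟩⟩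
  exact Group.IsPerfect.not_isSolvable f.range inferInstance

theorem Equiv.Perm.isSolvable_of_card_le_three {α : Type*} [Finite α] (h : Nat.card α ≤ 3) :
    Group.IsSolvable (Equiv.Perm α) := by
  classical
  have := Fintype.ofFinite α
  have hA : Group.IsSolvable (alternatingGroup α) := by
    rcases subsingleton_or_nontrivial α with hs | hs
    · infer_instance
    have hc : Nat.card (alternatingGroup α) = 1 ∨ Nat.card (alternatingGroup α) = 3 := by
      rw [nat_card_alternatingGroup]
      have : 1 < Nat.card α := Finite.one_lt_card
      interval_cases Nat.card α <;> simp [Nat.factorial]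
    rcases hc with hc | hc
    · have := (Nat.card_eq_one_iff_unique.mp hc).1
      infer_instance
    · have : Fact (Nat.Prime 3) := ⟨Nat.prime_three⟩
      have := isCyclic_of_prime_card hc
      exact Group.isSolvable_of_comm fun a b => IsMulCommutative.is_comm.comm a b
  exact Group.isSolvable_of_ker_le_range (alternatingGroup α).subtype Equiv.Perm.sign
    (by rw [Subgroup.range_subtype]; exact le_rfl)

theorem Group.IsPerfect.smul_eq_of_card_le_three {G α : Type*} [Group G] [Group.IsPerfect G]
    [MulAction G α] [Finite α] (h : Nat.card α ≤ 3) (g : G) (a : α) : g • a = a := by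
  have := Equiv.Perm.isSolvable_of_card_le_three h
  exact DFunLike.congr_fun (Group.IsPerfect.map_eq_one (MulAction.toPermHom G α) g) a

theorem Group.IsPerfect.index_ne_three {G : Type*} [Group G] [Group.IsPerfect G]
    (S : Subgroup G) : S.index ≠ 3 := by
  intro h
  have hfin : Finite (G ⧸ S) := Nat.finite_of_card_ne_zero (by rw [← Subgroup.index, h]; simp)
  have htop : S = ⊤ := by
    refine (Subgroup.eq_top_iff' S).2 fun g => ?_
    have := Group.IsPerfect.smul_eq_of_card_le_three (α := G ⧸ S) h.le g ((1 : G) : G ⧸ S)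
    rw [MulAction.Quotient.smul_mk, eq_comm, QuotientGroup.eq] at this
    simpa using this
  simp [htop] at h

theorem Group.IsPerfect.card_ne_two_pow_mul_three {G : Type*} [Group G] [Finite G]
    [Group.IsPerfect G] (k : ℕ) : Nat.card G ≠ 2 ^ k * 3 := by
  intro h
  have : Fact (Nat.Prime 2) := ⟨Nat.prime_two⟩
  obtain ⟨S⟩ : Nonempty (Sylow 2 G) := inferInstance
  have hS : Nat.card S = 2 ^ k := by
    rw [S.card_eq_multiplicity, h, Nat.factorization_mul (by positivity) (by norm_num),
      Nat.Prime.factorization_pow Nat.prime_two]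
    simp [Nat.factorization_eq_zero_of_not_dvd]
  have := (S : Subgroup G).card_mul_index
  rw [h, hS] at this
  exact Group.IsPerfect.index_ne_three (S : Subgroup G)
    (Nat.eq_of_mul_eq_mul_left (by positivity) this)

/-- The possible orbit sizes of a rotation group with three exceptional orbits. -/
theorem three_orbit_card_cases {N a b c x y z : ℕ} (hx : a * x = N) (hy : b * y = N)
    (hz : c * z = N) (hxy : x ≤ y) (hyz : y ≤ z) (hx2 : 2 ≤ x) (hc : 4 ≤ c)
    (h : a + b + c = N + 2) : N = 12 ∨ N = 24 ∨ N = 60 := by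
  -- Dividing `h` by `N` gives $1/x+1/y+1/z=1+2/N>1$, which bounds each of `x`, `y`, `z` in turn.
  have h1 : x < 3 := by
    by_contra hlt
    have h1 := Nat.mul_le_mul_left a (show 3 ≤ x by lia)
    have h2 := Nat.mul_le_mul_left b (show 3 ≤ y by lia)
    have h3 := Nat.mul_le_mul_left c (show 3 ≤ z by lia)
    lia
  obtain rfl : x = 2 := by lia
  have h2 : y < 4 := by
    by_contra hlt
    have h2 := Nat.mul_le_mul_left b (show 4 ≤ y by lia)
    have h3 := Nat.mul_le_mul_left c (show 4 ≤ z by lia)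
    lia
  have h3 : z < 6 ∨ y = 2 := by
    by_contra! hlt
    have h2 := Nat.mul_le_mul_left b (show 3 ≤ y by lia)
    have h3 := Nat.mul_le_mul_left c hlt.1
    lia
  interval_cases y
  -- The dihedral case: `x = y = 2` forces `c = 2`, against `hc`.
  · lia
  · have h3 : z < 6 := by lia
    interval_cases z <;> lia

open MulAction in
-- Klein's argument: Burnside's lemma on the points with nontrivial stabilizer leaves the orders 12,
-- 24 and 60. The first two would give a subgroup of index 3. Orbits have at least 4 points, since a
-- perfect group acts trivially on at most 3.
theorem Group.IsPerfect.card_eq_sixty_of_ncard_fixedBy_eq_two {G Y : Type*} [Group G] [Finite G]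
    [Nontrivial G] [Group.IsPerfect G] [MulAction G Y]
    (hfix : ∀ g : G, g ≠ 1 → (fixedBy Y g).ncard = 2) (hglob : ∀ y : Y, ∃ g : G, g • y ≠ y) :
    Nat.card G = 60 := by
  classical
  have := Fintype.ofFinite G
  let X : SubMulAction G Y :=
    { carrier := {y | ∃ g : G, g ≠ 1 ∧ g • y = y}
      smul_mem' := by
        rintro c y ⟨g, hg, hgy⟩
        refine ⟨c * g * c⁻¹, by simpa using hg, ?_⟩
        simp [mul_smul, hgy] }
  have hXfin : (X : Set Y).Finite := by
    have : (X : Set Y) ⊆ ⋃ g ∈ {g : G | g ≠ 1}, fixedBy Y g := by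
      rintro y ⟨g, hg, hgy⟩
      simp only [Set.mem_iUnion]
      exact ⟨g, hg, hgy⟩
    refine Set.Finite.subset (Set.Finite.biUnion (Set.toFinite _) fun g hg => ?_) this
    exact Set.finite_of_ncard_ne_zero (by rw [hfix g hg]; simp)
  have : Finite X := hXfin.to_subtype
  have := Fintype.ofFinite X
  have hfixX : ∀ g : G, g ≠ 1 → Fintype.card (fixedBy X g) = 2 := by
    intro g hg
    rw [← Nat.card_eq_fintype_card, ← hfix g hg, ← Nat.card_coe_set_eq]
    refine Nat.card_congr ⟨fun y => ⟨y.1.1, congrArg Subtype.val y.2⟩,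
      fun y => ⟨⟨y.1, g, hg, y.2⟩, Subtype.ext y.2⟩, fun _ => rfl, fun _ => rfl⟩
  set N := Nat.card G with hN
  have hN1 : 1 < N := Finite.one_lt_card
  let Ω := Quotient (orbitRel G X)
  have := Fintype.ofFinite Ω
  have hburn : Nat.card X + 2 * (N - 1) = Nat.card Ω * N := by
    have h := sum_card_fixedBy_eq_card_orbits_mul_card_group G X
    rw [← Finset.add_sum_erase _ _ (Finset.mem_univ (1 : G)),
      Finset.sum_congr rfl fun g hg => hfixX g (Finset.ne_of_mem_erase hg)] at h
    rw [Finset.sum_const, Finset.card_erase_of_mem (Finset.mem_univ _), Finset.card_univ,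
      smul_eq_mul] at h
    have h1 : Fintype.card (fixedBy X (1 : G)) = Nat.card X := by
      rw [← Nat.card_eq_fintype_card]
      simp [Set.ncard_univ]
    rw [h1, ← Nat.card_eq_fintype_card (α := G), ← hN] at h
    rw [Nat.card_eq_fintype_card (α := Ω), mul_comm 2]
    convert h using 2
  let m : Ω → ℕ := fun ω => Nat.card (orbit G ω.out)
  let n : Ω → ℕ := fun ω => Nat.card (stabilizer G ω.out)
  have hmn : ∀ ω, m ω * n ω = N := by
    intro ω
    simp only [m, n]
    rw [Nat.card_coe_set_eq, ← index_stabilizer, mul_comm]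
    exact Subgroup.card_mul_index _
  have hsum : ∑ ω, m ω = Nat.card X := by
    rw [Nat.card_congr (selfEquivSigmaOrbits G X), Nat.card_sigma]
  have hn2 : ∀ ω, 2 ≤ n ω := by
    intro ω
    obtain ⟨g, hg, hgy⟩ := ω.out.2
    have : Nontrivial (stabilizer G ω.out) :=
      ⟨⟨⟨g, Subtype.ext hgy⟩, 1, fun h => hg (congrArg Subtype.val h)⟩⟩
    exact Finite.one_lt_card
  have hm4 : ∀ ω, 4 ≤ m ω := by
    intro ω
    by_contra! hlt
    obtain ⟨g, hg⟩ := hglob ω.out.1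
    have := Group.IsPerfect.smul_eq_of_card_le_three (α := orbit G ω.out) (by lia) g
      ⟨ω.out, mem_orbit_self _⟩
    exact hg (congrArg Subtype.val (congrArg Subtype.val this))
  have hm2 : 2 * Nat.card X ≤ Nat.card Ω * N := by
    rw [← hsum, Finset.mul_sum, Nat.card_eq_fintype_card, ← Finset.card_univ, ← smul_eq_mul,
      ← Finset.sum_const]
    refine Finset.sum_le_sum fun ω _ => ?_
    rw [← hmn ω, mul_comm]
    exact Nat.mul_le_mul_left _ (hn2 ω)
  have hm4' : Nat.card Ω * 4 ≤ Nat.card X := by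
    rw [← hsum, Nat.card_eq_fintype_card, ← Finset.card_univ, ← smul_eq_mul,
      ← Finset.sum_const]
    exact Finset.sum_le_sum fun ω _ => hm4 ω
  -- With $k$ orbits, `hburn` and `hm2` give $kN\le4N-4$, while $k\le2$ leaves at most 2 points, too
  -- few for `hm4'`.
  have hk : Nat.card Ω = 3 := by
    have hlt : Nat.card Ω < 4 := by
      by_contra! h4
      have := Nat.mul_le_mul_right N h4
      lia
    interval_cases Nat.card Ω <;> lia
  have hX : Nat.card X = N + 2 := by rw [hk] at hburn; lia
  let e : Fin 3 ≃ Ω := (Finite.equivFinOfCardEq hk).symm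
  let σ : Equiv.Perm (Fin 3) := Tuple.sort (n ∘ e)
  have hmono : Monotone ((n ∘ e) ∘ σ) := Tuple.monotone_sort (n ∘ e)
  have hsum3 : m (e (σ 0)) + m (e (σ 1)) + m (e (σ 2)) = N + 2 := by
    rw [← hX, ← hsum, ← (σ.trans e).sum_comp, Fin.sum_univ_three]
    rfl
  have hcases := three_orbit_card_cases (hmn (e (σ 0))) (hmn (e (σ 1))) (hmn (e (σ 2)))
    (hmono (by decide : (0 : Fin 3) ≤ 1)) (hmono (by decide : (1 : Fin 3) ≤ 2)) (hn2 _) (hm4 _)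
    hsum3
  have h12 := Group.IsPerfect.card_ne_two_pow_mul_three (G := G) 2
  have h24 := Group.IsPerfect.card_ne_two_pow_mul_three (G := G) 3
  lia

/-! ### Finite perfect subgroups of $SL_2$ in coprime characteristic -/

section LinearGroup

open Matrix LinearAlgebra.Projectivization

variable {K : Type*} [Field K]

theorem Matrix.mul_self_eq_trace_smul_sub_one {A : Matrix (Fin 2) (Fin 2) K} (hdet : A.det = 1) :
    A * A = A.trace • A - 1 := by
  rw [det_fin_two] at hdet
  ext i j
  fin_cases i <;> fin_cases j <;> simp [Matrix.mul_apply, trace_fin_two]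
  · linear_combination -hdet
  · ring
  · ring
  · linear_combination -hdet

theorem Matrix.smul_one_add_pow_of_mul_self_eq_zero {B : Matrix (Fin 2) (Fin 2) K} (hB : B * B = 0)
    (a : K) (m : ℕ) :
    (a • (1 : Matrix (Fin 2) (Fin 2) K) + B) ^ (m + 1) =
      a ^ (m + 1) • 1 + ((m + 1 : ℕ) * a ^ m) • B := by
  induction m with
  | zero => simp
  | succ m ih =>
    rw [pow_succ, ih]
    simp only [add_mul, mul_add, smul_mul_assoc, mul_smul_comm, hB, mul_one, one_mul,
      smul_zero, add_zero]
    rw [smul_add, smul_smul, smul_smul, add_assoc, ← add_smul]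
    congr 2 <;> push_cast <;> ring

theorem Matrix.eigenvalue_quadratic {A : Matrix (Fin 2) (Fin 2) K} (hdet : A.det = 1) {a : K}
    {v : Fin 2 → K} (hv : v ≠ 0) (hAv : A *ᵥ v = a • v) : a * a = A.trace * a - 1 := by
  have h := congrArg (· *ᵥ v) (mul_self_eq_trace_smul_sub_one hdet)
  simp only [← mulVec_mulVec, hAv, mulVec_smul, sub_mulVec, smul_mulVec, one_mulVec, smul_smul] at h
  obtain ⟨i, hi⟩ := Function.ne_iff.mp hv
  have := congrFun h i
  simp only [Pi.smul_apply, Pi.sub_apply, smul_eq_mul] at this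
  refine mul_right_cancel₀ hi ?_
  linear_combination this

/-- A finite-order element of `SL₂` of order prime to the characteristic with an eigenvector is
either scalar or has a second, distinct, eigenvalue. -/
theorem Matrix.eq_smul_one_or_exists_eigenvector {A : Matrix (Fin 2) (Fin 2) K} (hdet : A.det = 1)
    {m : ℕ} (hm : (m : K) ≠ 0) (hA : A ^ m = 1) {a : K} {v : Fin 2 → K} (hv : v ≠ 0)
    (hAv : A *ᵥ v = a • v) :
    A = a • 1 ∨ ∃ b, a ≠ b ∧ a * b = 1 ∧ ∃ w : Fin 2 → K, w ≠ 0 ∧ A *ᵥ w = b • w := by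
  have hq := eigenvalue_quadratic hdet hv hAv
  have hab : a * (A.trace - a) = 1 := by linear_combination -hq
  have ha : a ≠ 0 := left_ne_zero_of_mul_eq_one hab
  set B := A - a • (1 : Matrix (Fin 2) (Fin 2) K) with hB
  have hAB : A = a • 1 + B := by rw [hB]; abel
  -- Cayley–Hamilton: nonzero vectors in the image of `B` are eigenvectors for the other root.
  have hAB' : A * B = (A.trace - a) • B := by
    rw [hB, mul_sub, mul_self_eq_trace_smul_sub_one hdet, sub_smul, smul_sub, smul_sub, smul_smul,
      smul_smul, mul_smul_comm, mul_one]
    have h1 : A.trace * a = a * a + 1 := by linear_combination -hq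
    rw [h1, add_smul, one_smul]
    abel
  rcases eq_or_ne B 0 with h0 | h0
  · left
    rw [hAB, h0, add_zero]
  right
  by_cases hne : a = A.trace - a
  -- A double root makes `B` nilpotent, and $A^m=a^m+ma^{m-1}B=1$ then forces $B=0$.
  · exfalso
    have hBB : B * B = 0 := by
      nth_rewrite 1 [hB]
      rw [sub_mul, hAB', smul_mul_assoc, one_mul, ← hne, sub_self]
    obtain ⟨k, rfl⟩ : ∃ k, m = k + 1 :=
      Nat.exists_eq_succ_of_ne_zero (by rintro rfl; simp at hm)
    have hpow := smul_one_add_pow_of_mul_self_eq_zero hBB a k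
    rw [← hAB, hA] at hpow
    have hBv : B *ᵥ v = 0 := by rw [hB, sub_mulVec, hAv, smul_mulVec, one_mulVec, sub_self]
    have hak : a ^ (k + 1) = 1 := by
      have h := congrArg (· *ᵥ v) hpow
      simp only [add_mulVec, smul_mulVec, one_mulVec, hBv, smul_zero, add_zero] at h
      obtain ⟨i, hi⟩ := Function.ne_iff.mp hv
      have := congrFun h i
      simp only [Pi.smul_apply, smul_eq_mul] at this
      exact mul_right_cancel₀ hi (by rw [one_mul]; exact this.symm)
    rw [hak, one_smul, left_eq_add] at hpow
    exact (smul_ne_zero (mul_ne_zero hm (pow_ne_zero _ ha)) h0) hpow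
  · refine ⟨_, hne, hab, ?_⟩
    obtain ⟨u, hu⟩ : ∃ u, B *ᵥ u ≠ 0 := by
      by_contra! h
      exact h0 (mulVec_injective (funext fun u => by rw [h u, zero_mulVec]))
    exact ⟨B *ᵥ u, hu, by rw [mulVec_mulVec, hAB', smul_mulVec]⟩

/-- If `A` has an eigenvector `w` with eigenvalue other than `a`, then its `a`-eigenspace has
dimension at most one. -/
theorem Matrix.exists_smul_eq_of_eigenvector {A : Matrix (Fin 2) (Fin 2) K} {a b : K} (hab : a ≠ b)
    {u v w : Fin 2 → K} (hv : v ≠ 0) (hw : w ≠ 0) (hAu : A *ᵥ u = a • u) (hAv : A *ᵥ v = a • v)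
    (hAw : A *ᵥ w = b • w) : ∃ c : K, c • v = u := by
  have hD : u 0 * v 1 - u 1 * v 0 = 0 := by
    -- Cramer's rule: if `u`, `v` were independent, `w` would lie in the `a`-eigenspace.
    have hcr : (u 0 * v 1 - u 1 * v 0) • w =
        (w 0 * v 1 - w 1 * v 0) • u + (u 0 * w 1 - u 1 * w 0) • v := by
      ext i
      fin_cases i <;> simp <;> ring
    have h := congrArg (A *ᵥ ·) hcr
    simp only [mulVec_add, mulVec_smul, hAu, hAv, hAw] at h
    rw [smul_comm, hcr, smul_comm _ a, smul_comm _ a, ← smul_add, ← hcr, smul_smul, smul_smul,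
      ← sub_eq_zero, ← sub_smul, ← sub_mul] at h
    have := (smul_eq_zero.mp h).resolve_right hw
    exact (mul_eq_zero.mp this).resolve_left (sub_ne_zero.mpr hab.symm)
  by_cases h0 : v 0 = 0
  · have h1 : v 1 ≠ 0 := by
      intro h1
      exact hv (by ext i; fin_cases i <;> assumption)
    have hu0 : u 0 = 0 := by
      rw [h0, mul_zero, sub_zero] at hD
      exact (mul_eq_zero.mp hD).resolve_right h1
    refine ⟨u 1 / v 1, ?_⟩
    ext i
    fin_cases i <;> simp [h0, hu0, h1]
  · refine ⟨u 0 / v 0, ?_⟩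
    ext i
    fin_cases i
    · simp [h0]
    · simp only [Fin.mk_one, Pi.smul_apply, smul_eq_mul]
      field_simp
      linear_combination hD

theorem Matrix.SpecialLinearGroup.smul_projectivization_mk_eq_iff {g : Matrix.SpecialLinearGroup (Fin 2) K}
    {v : Fin 2 → K} (hv : v ≠ 0) :
    g • Projectivization.mk K v hv = Projectivization.mk K v hv ↔
      ∃ a : K, (g : Matrix (Fin 2) (Fin 2) K) *ᵥ v = a • v := by
  rw [Projectivization.smul_mk, Projectivization.mk_eq_mk_iff']
  exact exists_congr fun a => eq_comm

theorem Matrix.SpecialLinearGroup.ncard_fixedBy_projectivization [IsAlgClosed K]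
    {g : Matrix.SpecialLinearGroup (Fin 2) K} {m : ℕ} (hm : (m : K) ≠ 0) (hg : g ^ m = 1)
    (hne : ∃ x : ℙ K (Fin 2 → K), g • x ≠ x) :
    (MulAction.fixedBy (ℙ K (Fin 2 → K)) g).ncard = 2 := by
  obtain ⟨A, hgA⟩ : ∃ A, (g : Matrix (Fin 2) (Fin 2) K) = A := ⟨_, rfl⟩
  have hdet : A.det = 1 := hgA ▸ g.2
  have hA : A ^ m = 1 := by
    rw [← hgA, ← Matrix.SpecialLinearGroup.coe_pow, hg, Matrix.SpecialLinearGroup.coe_one]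
  have hscalar : ∀ c : K, A ≠ c • 1 := by
    rintro c rfl
    obtain ⟨x, hx⟩ := hne
    induction x with
    | h v hv =>
      exact hx ((smul_projectivization_mk_eq_iff hv).2 ⟨c, by simp [hgA, smul_mulVec]⟩)
  obtain ⟨a, ha⟩ := Module.End.exists_eigenvalue A.mulVecLin
  obtain ⟨v, hAv, hv⟩ := ha.exists_hasEigenvector
  rw [Module.End.mem_eigenspace_iff, mulVecLin_apply] at hAv
  obtain ⟨b, hab, -, w, hw, hAw⟩ :=
    (eq_smul_one_or_exists_eigenvector hdet hm hA hv hAv).resolve_left (hscalar a)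
  rw [Set.ncard_eq_two]
  refine ⟨Projectivization.mk K v hv, Projectivization.mk K w hw, ?_, ?_⟩
  · rw [ne_eq, Projectivization.mk_eq_mk_iff']
    rintro ⟨c, rfl⟩
    rw [mulVec_smul, hAw, smul_comm, ← sub_eq_zero, ← sub_smul] at hAv
    exact hv ((smul_eq_zero.mp hAv).resolve_left (sub_ne_zero.mpr hab.symm))
  · ext x
    induction x with
    | h u hu =>
      rw [MulAction.mem_fixedBy, Set.mem_insert_iff, Set.mem_singleton_iff,
        smul_projectivization_mk_eq_iff, hgA, Projectivization.mk_eq_mk_iff',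
        Projectivization.mk_eq_mk_iff']
      constructor
      · rintro ⟨c, hc⟩
        have h1 := eigenvalue_quadratic hdet hu hc
        have h2 := eigenvalue_quadratic hdet hv hAv
        have h3 := eigenvalue_quadratic hdet hw hAw
        have h4 : A.trace = a + b := by
          refine mul_left_cancel₀ (sub_ne_zero.mpr hab) ?_
          linear_combination h3 - h2
        have h5 : (c - a) * (c - b) = 0 := by
          rw [h4] at h1 h2
          linear_combination h1 - h2
        rcases mul_eq_zero.mp h5 with h | h
        · obtain rfl := sub_eq_zero.mp h
          exact Or.inl (exists_smul_eq_of_eigenvector hab hv hw hc hAv hAw)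
        · obtain rfl := sub_eq_zero.mp h
          exact Or.inr (exists_smul_eq_of_eigenvector hab.symm hw hv hc hAw hAv)
      · rintro (⟨c, rfl⟩ | ⟨c, rfl⟩)
        · exact ⟨a, by rw [mulVec_smul, hAv, smul_comm]⟩
        · exact ⟨b, by rw [mulVec_smul, hAw, smul_comm]⟩

variable {H : Type*} [Group H] [Group.IsPerfect H]

/-- A perfect subgroup of `SL₂` fixing a line fixes it pointwise. -/
theorem Group.IsPerfect.mulVec_eq_of_forall_eigenvector (ρ : H →* Matrix.SpecialLinearGroup (Fin 2) K)
    {v : Fin 2 → K} (h : ∀ x : H, ∃ a : K, (ρ x : Matrix (Fin 2) (Fin 2) K) *ᵥ v = a • v) (x : H) :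
    (ρ x : Matrix (Fin 2) (Fin 2) K) *ᵥ v = v := by
  let S : Subgroup H := (MulAction.stabilizer (Matrix.SpecialLinearGroup (Fin 2) K) v).comap ρ
  have hS : commutator H ≤ S := by
    rw [commutator_def, Subgroup.commutator_le]
    intro y _ z _
    change ρ (y * z * y⁻¹ * z⁻¹) • v = v
    have hsm : ∀ t : H, ∃ a : K, ρ t • v = a • v := h
    obtain ⟨a, ha⟩ := hsm y
    obtain ⟨b, hb⟩ := hsm z
    obtain ⟨c, hc⟩ := hsm (z * y)⁻¹
    have h1 : ρ (z * y) • ρ (z * y)⁻¹ • v = v := by rw [← mul_smul, ← map_mul]; simp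
    have h2 : y * z * y⁻¹ * z⁻¹ = y * z * (z * y)⁻¹ := by group
    rw [h2]
    have hlin : ∀ (t : H) (r : K) (u : Fin 2 → K), ρ t • r • u = r • ρ t • u :=
      fun t r u => smul_comm _ _ _
    rw [hc, map_mul, mul_smul, hlin, hlin, ha, hlin, hb] at h1
    rw [map_mul, mul_smul, hc, map_mul, mul_smul, hlin, hlin, hb, hlin, ha, smul_comm b]
    exact h1
  rw [Group.IsPerfect.commutator_eq_top] at hS
  exact hS (Subgroup.mem_top x)

theorem Group.IsPerfect.exists_not_eigenvector [Finite H] [Nontrivial H]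
    (hchar : (Nat.card H : K) ≠ 0) {ρ : H →* Matrix.SpecialLinearGroup (Fin 2) K}
    (hρ : Function.Injective ρ) {v : Fin 2 → K} (hv : v ≠ 0) :
    ∃ x : H, ¬ ∃ a : K, (ρ x : Matrix (Fin 2) (Fin 2) K) *ᵥ v = a • v := by
  by_contra! h
  obtain ⟨x, hx⟩ := exists_ne (1 : H)
  have hxv := Group.IsPerfect.mulVec_eq_of_forall_eigenvector ρ h x
  have hpow : (ρ x : Matrix (Fin 2) (Fin 2) K) ^ Nat.card H = 1 := by
    rw [← Matrix.SpecialLinearGroup.coe_pow, ← map_pow, pow_card_eq_one', map_one,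
      Matrix.SpecialLinearGroup.coe_one]
  rcases eq_smul_one_or_exists_eigenvector (ρ x).2 hchar hpow hv (a := 1)
    (by rw [one_smul]; exact hxv) with h1 | ⟨b, hb, hb', -⟩
  · refine hx (hρ ?_)
    rw [map_one]
    exact Subtype.ext (by simpa using h1)
  · exact hb (by simpa using hb'.symm)

/-- The image in the permutations of the projective line has order 60. The kernel has even order
because an involution in $SL_2$ is scalar. -/
theorem Group.IsPerfect.dvd_card_of_injective_specialLinearGroup [IsAlgClosed K] [Finite H]
    [Nontrivial H] (hchar : (Nat.card H : K) ≠ 0) {ρ : H →* Matrix.SpecialLinearGroup (Fin 2) K}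
    (hρ : Function.Injective ρ) : 120 ∣ Nat.card H := by
  let f : H →* Equiv.Perm (ℙ K (Fin 2 → K)) := (MulAction.toPermHom _ _).comp ρ
  have : Group.IsPerfect f.range := Group.IsPerfect.range f
  have : Finite f.range := Set.finite_range f
  have hglob : ∀ y : ℙ K (Fin 2 → K), ∃ g : f.range, g • y ≠ y := by
    intro y
    induction y with
    | h v hv =>
      obtain ⟨x, hx⟩ := exists_not_eigenvector hchar hρ hv
      refine ⟨⟨f x, x, rfl⟩, fun h => hx ?_⟩
      exact (Matrix.SpecialLinearGroup.smul_projectivization_mk_eq_iff hv).1 h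
  have : Nontrivial f.range := by
    obtain ⟨v, hv⟩ := exists_ne (0 : Fin 2 → K)
    obtain ⟨g, hg⟩ := hglob (Projectivization.mk K v hv)
    exact ⟨⟨g, 1, fun h => hg (by rw [h, one_smul])⟩⟩
  have hrange : Nat.card f.range = 60 := by
    refine card_eq_sixty_of_ncard_fixedBy_eq_two ?_ hglob
    rintro ⟨_, x, rfl⟩ hx
    refine Matrix.SpecialLinearGroup.ncard_fixedBy_projectivization hchar (g := ρ x)
      (by rw [← map_pow, pow_card_eq_one', map_one]) ?_
    by_contra! h
    exact hx (Subtype.ext (Equiv.ext h))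
  have hcard := f.ker.card_mul_index
  rw [Subgroup.index_ker, hrange] at hcard
  have h2 : 2 ∣ Nat.card H := by lia
  have : Fact (Nat.Prime 2) := ⟨Nat.prime_two⟩
  have hK2 : (2 : K) ≠ 0 := by
    intro h
    obtain ⟨k, hk⟩ := h2
    exact hchar (by rw [hk]; simp [h])
  obtain ⟨t, ht⟩ := exists_prime_orderOf_dvd_card' 2 h2
  have htker : t ∈ f.ker := by
    have ht2 : t ^ 2 = 1 := ht ▸ pow_orderOf_eq_one t
    have h1 : (ρ t : Matrix (Fin 2) (Fin 2) K) * ρ t = 1 := by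
      rw [← Matrix.SpecialLinearGroup.coe_mul, ← map_mul, ← pow_two, ht2, map_one,
        Matrix.SpecialLinearGroup.coe_one]
    set A := (ρ t : Matrix (Fin 2) (Fin 2) K) with hA
    -- Cayley–Hamilton turns $A^2=1$ into $\mathrm{tr}(A)A=2$.
    rw [mul_self_eq_trace_smul_sub_one (ρ t).2, sub_eq_iff_eq_add, ← two_smul K] at h1
    have htr : A.trace ≠ 0 := by
      intro h
      rw [h, zero_smul] at h1
      exact smul_ne_zero hK2 one_ne_zero h1.symm
    rw [MonoidHom.mem_ker]
    ext y
    induction y with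
    | h v hv =>
      refine (Matrix.SpecialLinearGroup.smul_projectivization_mk_eq_iff hv).2 ⟨A.trace⁻¹ * 2, ?_⟩
      have := congrArg (· *ᵥ v) h1
      simp only [smul_mulVec, one_mulVec] at this
      rw [mul_smul, ← this, smul_smul, inv_mul_cancel₀ htr, one_smul]
  have hker := Subgroup.orderOf_dvd_natCard _ htker
  rw [ht] at hker
  lia

end LinearGroup

/-! ### Transfer into an abelian Sylow subgroup -/

section Transfer

variable {G : Type*} [Group G] [Finite G] {p : ℕ} [Fact p.Prime]

theorem Group.IsPerfect.not_dvd_card_of_normalizer_le_centralizer [Group.IsPerfect G]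
    (P : Sylow p G)
    (hP : Subgroup.normalizer (P : Set G) ≤ Subgroup.centralizer (P : Set G)) :
    ¬ p ∣ Nat.card G := by
  have hsolv : Group.IsSolvable P := Group.isSolvable_of_comm fun a b =>
    Subtype.ext (hP (Subgroup.le_normalizer b.2) a a.2)
  have hker : (MonoidHom.transferSylow P hP).ker = ⊤ :=
    (Subgroup.eq_top_iff' _).2 fun g => Group.IsPerfect.map_eq_one _ g
  have := MonoidHom.not_dvd_card_ker_transferSylow P hP
  rwa [hker, Subgroup.card_top] at this

/-- If a Sylow subgroup is abelian of exponent dividing `p ^ 2` and its elements of order `p` are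
central, then its normalizer centralizes it. -/
theorem Sylow.normalizer_le_centralizer_of_pow_eq_one_mem_center (P : Sylow p G)
    (hcomm : ∀ x ∈ P, ∀ y ∈ P, x * y = y * x) (hexp : ∀ x ∈ P, x ^ p ^ 2 = 1)
    (hcenter : ∀ x : G, x ^ p = 1 → x ∈ Subgroup.center G) :
    Subgroup.normalizer (P : Set G) ≤ Subgroup.centralizer (P : Set G) := by
  have hp : p.Prime := Fact.out
  intro n hn
  rw [Subgroup.mem_centralizer_iff]
  intro x hx
  have hconj : n * x * n⁻¹ ∈ P := (Subgroup.mem_normalizer_iff.1 hn x).1 hx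
  set w := n * x * n⁻¹ * x⁻¹ with hw
  -- The element $x^p$ is killed by $p$, hence central, so conjugation by `n` fixes it.
  have hwp : w ^ p = 1 := by
    have h1 : Commute (n * x * n⁻¹) x⁻¹ := hcomm _ hconj _ (inv_mem hx)
    have h2 : x ^ p ∈ Subgroup.center G :=
      hcenter _ (by rw [← pow_mul, ← pow_two, hexp x hx])
    rw [hw, h1.mul_pow, conj_pow, Subgroup.mem_center_iff.1 h2 n, mul_inv_cancel_right,
      inv_pow, mul_inv_cancel]
  have hwc := Subgroup.mem_center_iff.1 (hcenter w hwp)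
  have hnx : n * x = w * x * n := by rw [hw]; group
  have hpow : ∀ k : ℕ, n ^ k * x = w ^ k * x * n ^ k := by
    intro k
    induction k with
    | zero => simp
    | succ k ih =>
      have hc : Commute (w ^ k) n := Commute.pow_left (hwc n).symm k
      calc n ^ (k + 1) * x = n * (n ^ k * x) := by rw [pow_succ', mul_assoc]
        _ = n * w ^ k * x * n ^ k := by rw [ih]; simp only [mul_assoc]
        _ = w ^ k * (n * x) * n ^ k := by rw [← hc.eq]; simp only [mul_assoc]
        _ = w ^ (k + 1) * x * n ^ (k + 1) := by
          rw [hnx, pow_succ, pow_succ']; simp only [mul_assoc]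
  obtain ⟨a, m, hm, hord⟩ := Nat.exists_eq_pow_mul_and_not_dvd (orderOf_pos n).ne' p hp.ne_one
  -- A $p$-element normalizing `P` lies in `P`, so it commutes with `x`; with `hpow` this gives
  -- $w^m=1$ for `m` prime to `p`.
  have hnm : n ^ m ∈ P := by
    have hz : IsPGroup p (Subgroup.zpowers (n ^ m)) := by
      have hd : Nat.card (Subgroup.zpowers (n ^ m)) ∣ p ^ a := by
        rw [Nat.card_zpowers]
        refine orderOf_dvd_of_pow_eq_one ?_
        rw [← pow_mul, mul_comm, ← hord, pow_orderOf_eq_one]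
      obtain ⟨b, -, hb⟩ := (Nat.dvd_prime_pow hp).1 hd
      exact IsPGroup.of_card hb
    have hmem : n ^ m ∈ Subgroup.zpowers (n ^ m) ⊓ Subgroup.normalizer (P : Set G) :=
      ⟨Subgroup.mem_zpowers _, pow_mem hn m⟩
    have := hz.inf_normalizer_sylow P ▸ hmem
    exact this.2
  have hwm : w ^ m = 1 := by
    have h1 := hpow m
    rw [hcomm _ hnm _ hx, mul_assoc] at h1
    exact right_eq_mul.1 h1
  have hw1 : w = 1 := by
    rw [← orderOf_eq_one_iff, ← Nat.dvd_one,
      ← (Nat.Coprime.gcd_eq_one ((Nat.Prime.coprime_iff_not_dvd hp).2 hm))]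
    exact Nat.dvd_gcd (orderOf_dvd_of_pow_eq_one hwp) (orderOf_dvd_of_pow_eq_one hwm)
  rw [hnx, hw1, one_mul]

end Transfer

/-! ### Conjugation on normal subgroups of order $p$ and $p^2$ -/

section NormalSubgroup

variable {G : Type*} [Group G] [Group.IsPerfect G] {p : ℕ} [Fact p.Prime]

theorem Group.IsPerfect.le_center_of_card_eq_prime (N : Subgroup G) [N.Normal]
    (hN : Nat.card N = p) : N ≤ Subgroup.center G := by
  have : IsCyclic N := isCyclic_of_prime_card hN
  have hsolv : Group.IsSolvable (MulAut N) :=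
    Group.isSolvable_of_isSolvable_injective (f := (IsCyclic.mulAutMulEquiv N).toMonoidHom)
      (IsCyclic.mulAutMulEquiv N).injective
  intro x hx
  rw [Subgroup.mem_center_iff]
  intro g
  have h := congrArg Subtype.val
    (DFunLike.congr_fun (Group.IsPerfect.map_eq_one (MulAut.conjNormal (H := N)) g) ⟨x, hx⟩)
  rw [MulAut.conjNormal_apply] at h
  exact mul_inv_eq_iff_eq_mul.1 h

/-- An action of a perfect group on an elementary abelian group of order `p ^ 2` gives a
representation into `SL₂(𝔽_p)`. -/
theorem Group.IsPerfect.exists_hom_specialLinearGroup_of_addMonoidEnd {V : Type*} [AddCommGroup V]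
    [Module (ZMod p) V] (hV : Nat.card V = p ^ 2) (φ : G →* AddMonoid.End V) :
    ∃ ρ : G →* Matrix.SpecialLinearGroup (Fin 2) (ZMod p),
      ∀ g, ρ g = 1 ↔ ∀ x, φ g x = x := by
  have hp : p.Prime := Fact.out
  have : Finite V := Nat.finite_of_card_ne_zero (by rw [hV]; exact pow_ne_zero _ hp.ne_zero)
  have hrank : Module.finrank (ZMod p) V = 2 := by
    have h := Module.natCard_eq_pow_finrank (K := ZMod p) (V := V)
    rw [Nat.card_zmod, hV] at h
    exact (Nat.pow_right_injective hp.two_le h).symm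
  let b : Module.Basis (Fin 2) (ZMod p) V := Module.finBasisOfFinrankEq _ _ hrank
  let ψ : G →* Module.End (ZMod p) V :=
    { toFun := fun g => AddMonoidHom.toZModLinearMap p (φ g)
      map_one' := by rw [map_one]; rfl
      map_mul' := fun g h => by rw [map_mul]; rfl }
  let M : G →* Matrix (Fin 2) (Fin 2) (ZMod p) :=
    ((LinearMap.toMatrixAlgEquiv b : Module.End (ZMod p) V →* _)).comp ψ
  -- The determinant has values in an abelian group, so it is trivial on a perfect one.
  have hdet : ∀ g, (M g).det = 1 := fun g => by
    have h := Group.IsPerfect.map_eq_one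
      ((Matrix.detMonoidHom (n := Fin 2) (R := ZMod p)).comp M).toHomUnits g
    exact congrArg Units.val h
  let ρ : G →* Matrix.SpecialLinearGroup (Fin 2) (ZMod p) :=
    { toFun := fun g => ⟨M g, hdet g⟩
      map_one' := Subtype.ext (map_one M)
      map_mul' := fun g h => Subtype.ext (map_mul M g h) }
  have hρ : ∀ g, ρ g = 1 ↔ ψ g = 1 := fun g => Subtype.ext_iff.trans
    (map_eq_one_iff (LinearMap.toMatrixAlgEquiv b) (LinearMap.toMatrixAlgEquiv b).injective)
  exact ⟨ρ, fun g => (hρ g).trans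
    ⟨fun h x => LinearMap.congr_fun h x, fun h => LinearMap.ext h⟩⟩

open scoped IsMulCommutative in
/-- The conjugation action of a perfect group on a normal elementary abelian subgroup of order
`p ^ 2`, as a representation into `SL₂(𝔽_p)`. -/
theorem Group.IsPerfect.exists_hom_specialLinearGroup (N : Subgroup G) [N.Normal]
    (hcomm : ∀ x ∈ N, ∀ y ∈ N, x * y = y * x) (hexp : ∀ x ∈ N, x ^ p = 1)
    (hN : Nat.card N = p ^ 2) :
    ∃ ρ : G →* Matrix.SpecialLinearGroup (Fin 2) (ZMod p),
      ∀ g, ρ g = 1 ↔ ∀ x ∈ N, g * x = x * g := by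
  have : IsMulCommutative N := ⟨⟨fun x y => Subtype.ext (hcomm x x.2 y y.2)⟩⟩
  let _ : Module (ZMod p) (Additive N) := AddCommGroup.zmodModule fun x =>
    congrArg Additive.ofMul (Subtype.ext (hexp x.toMul x.toMul.2) : x.toMul ^ p = 1)
  let φ : G →* AddMonoid.End (Additive N) :=
    { toFun := fun g => MonoidHom.toAdditive (MulAut.conjNormal (H := N) g).toMonoidHom
      map_one' := by
        rw [map_one]
        rfl
      map_mul' := fun g h => by
        rw [map_mul]
        rfl }
  obtain ⟨ρ, hρ⟩ := Group.IsPerfect.exists_hom_specialLinearGroup_of_addMonoidEnd (p := p)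
    (V := Additive N) hN φ
  refine ⟨ρ, fun g => (hρ g).trans ⟨fun h x hx => ?_, fun h x => ?_⟩⟩
  · have h4 : ((MulAut.conjNormal g (⟨x, hx⟩ : N) : N) : G) = x :=
      congrArg (fun y : Additive N => (y.toMul : G)) (h (Additive.ofMul ⟨x, hx⟩))
    rw [MulAut.conjNormal_apply] at h4
    exact mul_inv_eq_iff_eq_mul.1 h4
  · refine congrArg Additive.ofMul
      (Subtype.ext ?_ : MulAut.conjNormal g (Additive.toMul x) = Additive.toMul x)
    rw [MulAut.conjNormal_apply]
    exact mul_inv_eq_iff_eq_mul.2 (h x.toMul x.toMul.2)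

end NormalSubgroup

/-! ### Images in $SL_2(\mathbb F_p)$ -/

section ModularRepresentation

variable {p : ℕ} [Fact p.Prime]

theorem Group.IsPerfect.dvd_card_range_specialLinearGroup_zmod {G : Type*} [Group G] [Finite G]
    [Group.IsPerfect G] (ρ : G →* Matrix.SpecialLinearGroup (Fin 2) (ZMod p))
    (hp : ¬ p ∣ Nat.card ρ.range) (hρ : ∃ g, ρ g ≠ 1) : 120 ∣ Nat.card ρ.range := by
  let K := AlgebraicClosure (ZMod p)
  have : Group.IsPerfect ρ.range := Group.IsPerfect.range ρ
  have : Finite ρ.range := Set.finite_range ρ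
  have : Nontrivial ρ.range := by
    obtain ⟨g, hg⟩ := hρ
    exact ⟨⟨⟨ρ g, g, rfl⟩, 1, fun h => hg (congrArg Subtype.val h)⟩⟩
  let f : ρ.range →* Matrix.SpecialLinearGroup (Fin 2) K :=
    (Matrix.SpecialLinearGroup.map (algebraMap (ZMod p) K)).comp ρ.range.subtype
  refine Group.IsPerfect.dvd_card_of_injective_specialLinearGroup (K := K) (ρ := f)
    (fun h => hp ((CharP.cast_eq_zero_iff K p _).1 h)) fun x y hxy => ?_
  refine Subtype.ext (Matrix.SpecialLinearGroup.ext _ _ fun i j => ?_)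
  have := congrArg (fun A : Matrix.SpecialLinearGroup (Fin 2) K => A i j) hxy
  exact (algebraMap (ZMod p) K).injective this

theorem Matrix.SpecialLinearGroup.modEq_of_five_dvd_card
    (h : 5 ∣ Nat.card (Matrix.SpecialLinearGroup (Fin 2) (ZMod p))) (h2 : p ≠ 2) (h5 : p ≠ 5) :
    p % 10 = 1 ∨ p % 10 = 9 := by
  have hp : p.Prime := Fact.out
  have hGL := h.trans (Subgroup.card_dvd_of_injective
    (Matrix.SpecialLinearGroup.toGL (n := Fin 2) (R := ZMod p))
    Matrix.SpecialLinearGroup.toGL_injective)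
  rw [Matrix.card_GL_field, ZMod.card, Fin.prod_univ_two, Nat.prime_five.dvd_mul] at hGL
  have hn2 : ¬ 2 ∣ p := fun h => h2 ((Nat.prime_dvd_prime_iff_eq Nat.prime_two hp).1 h).symm
  have hn5 : ¬ 5 ∣ p := fun h => h5 ((Nat.prime_dvd_prime_iff_eq Nat.prime_five hp).1 h).symm
  have hdvd : 5 ∣ (p + 1) * (p - 1) := by
    rcases hGL with h | h
    · rw [← Nat.sq_sub_sq]; simpa using h
    · have : p ^ 2 - p = p * (p - 1) := by rw [Nat.mul_sub, mul_one, pow_two]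
      simp only [Fin.val_one, pow_one, this] at h
      exact ((Nat.prime_five.dvd_mul.1 h).resolve_left hn5).mul_left _
  have := hp.two_le
  rcases Nat.prime_five.dvd_mul.1 hdvd with h | h <;> lia

end ModularRepresentation

/-! ### Groups with the POEC property -/

section POEC

variable {G : Type*} [Group G]

theorem IsPOEC.commute_of_pow_eq_one (h : IsPOEC G) {p q : ℕ} (hp : p.Prime) (hq : q.Prime)
    {x y : G} (hx : x ^ p = 1) (hy : y ^ q = 1) : Commute x y := by
  have := Fact.mk hp
  have := Fact.mk hq
  by_cases hx1 : x = 1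
  · rw [hx1]; exact Commute.one_left y
  by_cases hy1 : y = 1
  · rw [hy1]; exact Commute.one_right x
  refine h x y ?_ ?_
  · rwa [orderOf_eq_prime hx hx1]
  · rwa [orderOf_eq_prime hy hy1]

/-- In a POEC group, the elements of order dividing a prime `p` form a subgroup. -/
def IsPOEC.primeTorsion (h : IsPOEC G) {p : ℕ} (hp : p.Prime) : Subgroup G where
  carrier := {x | x ^ p = 1}
  one_mem' := one_pow p
  mul_mem' {x y} hx hy := by
    change (x * y) ^ p = 1
    rw [(h.commute_of_pow_eq_one hp hp hx hy).mul_pow, hx, hy, one_mul]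
  inv_mem' {x} hx := by
    change x⁻¹ ^ p = 1
    rw [inv_pow, hx, inv_one]

theorem IsPOEC.mem_primeTorsion (h : IsPOEC G) {p : ℕ} (hp : p.Prime) {x : G} :
    x ∈ h.primeTorsion hp ↔ x ^ p = 1 := Iff.rfl

theorem IsPOEC.normal_primeTorsion (h : IsPOEC G) {p : ℕ} (hp : p.Prime) :
    (h.primeTorsion hp).Normal :=
  ⟨fun x hx g => by
    rw [h.mem_primeTorsion] at hx ⊢
    rw [conj_pow, hx, mul_one, mul_inv_cancel]⟩

theorem IsPOEC.dvd_card_of_not_cube_dvd_card [Finite G] [Group.IsPerfect G] (h : IsPOEC G) {p : ℕ}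
    (hp : p.Prime) (hpG : p ∣ Nat.card G) (hcube : ¬ p ^ 3 ∣ Nat.card G) :
    240 ∣ Nat.card G ∧ (p % 10 = 1 ∨ p % 10 = 9) := by
  have := Fact.mk hp
  obtain ⟨P⟩ : Nonempty (Sylow p G) := inferInstance
  have hPnot : ¬ Subgroup.normalizer (P : Set G) ≤ Subgroup.centralizer (P : Set G) :=
    fun hP => Group.IsPerfect.not_dvd_card_of_normalizer_le_centralizer P hP hpG
  obtain ⟨k, hcardP⟩ := IsPGroup.iff_card.1 P.isPGroup'
  have hk2 : k ≤ 2 := by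
    by_contra! hk
    refine hcube ((pow_dvd_pow p hk).trans ?_)
    rw [← hcardP]
    exact Subgroup.card_subgroup_dvd_card _
  have hPcomm : ∀ x ∈ P, ∀ y ∈ P, x * y = y * x := by
    have hmul : IsMulCommutative P := by
      interval_cases k
      · have := (Nat.card_eq_one_iff_unique.1 (hcardP.trans (pow_zero p))).1
        exact ⟨⟨fun _ _ => Subsingleton.elim _ _⟩⟩
      · have := isCyclic_of_prime_card (by simpa using hcardP)
        infer_instance
      · exact IsPGroup.isMulCommutative_of_card_eq_prime_sq hcardP
    exact fun x hx y hy =>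
      congrArg Subtype.val (hmul.is_comm.comm (⟨x, hx⟩ : P) (⟨y, hy⟩ : P))
  have hPexp : ∀ x ∈ P, x ^ p ^ 2 = 1 := fun x hx => by
    have h1 : x ^ p ^ k = 1 := by
      rw [← hcardP]
      exact congrArg Subtype.val (pow_card_eq_one' (x := (⟨x, hx⟩ : P)))
    rw [← Nat.sub_add_cancel hk2, pow_add, mul_comm, pow_mul, h1, one_pow]
  let Ω := h.primeTorsion hp
  have hΩn : Ω.Normal := h.normal_primeTorsion hp
  have hΩp : IsPGroup p Ω := fun x => ⟨1, Subtype.ext (by rw [pow_one]; exact x.2)⟩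
  have hΩP : Ω ≤ P := hΩp.le_sylow_of_normal P
  obtain ⟨j, hj⟩ := IsPGroup.iff_card.1 hΩp
  have hj0 : j ≠ 0 := by
    rintro rfl
    obtain ⟨x, hx⟩ := exists_prime_orderOf_dvd_card' p hpG
    have hxΩ : x ^ p = 1 := hx ▸ pow_orderOf_eq_one x
    rw [← h.mem_primeTorsion hp] at hxΩ
    change x ∈ Ω at hxΩ
    rw [pow_zero, Subgroup.card_eq_one] at hj
    rw [hj, Subgroup.mem_bot] at hxΩ
    rw [hxΩ, orderOf_one] at hx
    exact hp.one_lt.ne hx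
  have hjk : j ≤ k := by
    have := Subgroup.card_dvd_of_le hΩP
    rw [hj, show Nat.card (P : Subgroup G) = p ^ k from hcardP] at this
    exact (Nat.pow_dvd_pow_iff_le_right hp.one_lt).1 this
  have hj2 : j = 2 := by
    by_contra hj2
    obtain rfl : j = 1 := by lia
    have hcent := Group.IsPerfect.le_center_of_card_eq_prime Ω (by simpa using hj)
    exact hPnot (P.normalizer_le_centralizer_of_pow_eq_one_mem_center hPcomm hPexp
      fun x hx => hcent hx)
  subst hj2
  have hPΩ : (P : Subgroup G) = Ω := by
    obtain rfl : k = 2 := by lia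
    exact (Subgroup.eq_of_le_of_card_ge hΩP (by rw [hj]; exact hcardP.le)).symm
  obtain ⟨ρ, hρ⟩ := Group.IsPerfect.exists_hom_specialLinearGroup (p := p) Ω
    (fun x hx y hy => h.commute_of_pow_eq_one hp hp hx hy) (fun x hx => hx) hj
  have hρ1 : ∃ g, ρ g ≠ 1 := by
    by_contra! hall
    refine hPnot fun g _ => Subgroup.mem_centralizer_iff.2 fun x hx => ?_
    have hxΩ : x ∈ Ω := hPΩ ▸ hx
    exact ((hρ g).1 (hall g) x hxΩ).symm
  have hPker : (P : Subgroup G) ≤ ρ.ker := fun x hx =>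
    (hρ x).2 fun y hy => hPcomm x hx y (hΩP hy)
  -- The kernel contains a full Sylow $p$-subgroup.
  have hprange : ¬ p ∣ Nat.card ρ.range := by
    rw [← Subgroup.index_ker]
    exact fun hd => P.not_dvd_index (hd.trans (Subgroup.index_dvd_of_le hPker))
  have h120 := Group.IsPerfect.dvd_card_range_specialLinearGroup_zmod ρ hprange hρ1
  have hne : ∀ q, q ∣ 120 → p ≠ q := by
    intro q hq hpq
    rw [← hpq] at hq
    exact hprange (hq.trans h120)
  have hcard := ρ.ker.card_mul_index
  rw [Subgroup.index_ker] at hcard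
  refine ⟨?_, Matrix.SpecialLinearGroup.modEq_of_five_dvd_card ?_ (hne 2 (by norm_num))
    (hne 5 (by norm_num))⟩
  · have : Fact (Nat.Prime 2) := ⟨Nat.prime_two⟩
    have h2G : 2 ∣ Nat.card G := by
      rw [← hcard]
      exact ((by norm_num : 2 ∣ 120).trans h120).mul_left _
    obtain ⟨t, ht⟩ := exists_prime_orderOf_dvd_card' 2 h2G
    have htker : t ∈ ρ.ker := (hρ t).2 fun x hx =>
      h.commute_of_pow_eq_one Nat.prime_two hp (ht ▸ pow_orderOf_eq_one t) hx
    have h2ker := Subgroup.orderOf_dvd_natCard _ htker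
    rw [ht] at h2ker
    rw [← hcard]
    exact mul_dvd_mul h2ker h120
  · exact ((by norm_num : 5 ∣ 120).trans h120).trans (Subgroup.card_subgroup_dvd_card _)

end POEC

theorem mainTheorem2 {G : Type*} [Group G] [Finite G]
    (hPerfect : Group.IsPerfect G) (hPOEC : IsPOEC G)
    (p : ℕ) (hp : p.Prime) (hpG : p ∣ Nat.card G)
    (h : (¬ 2 ^ 4 ∣ Nat.card G ∨ ¬ 3 ∣ Nat.card G ∨ ¬ 5 ∣ Nat.card G) ∨
      (¬ (p : ℤ) ≡ 1 [ZMOD 10] ∧ ¬ (p : ℤ) ≡ -1 [ZMOD 10])) :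
    p ^ 3 ∣ Nat.card G := by
  by_contra hcube
  obtain ⟨h240, hmod⟩ := hPOEC.dvd_card_of_not_cube_dvd_card hp hpG hcube
  simp only [Int.ModEq] at h
  lia
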